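/- Let $\Gamma$ denote the Gamma function on $\mathbb{R}\setminus\mathbb{Z}_{\le 0}$ and, for $n\ge 1$, let $\Gamma^{(n)}$ denote its $n$-th derivative. For every $q\in\mathbb{Q}\setminus\tfrac12\mathbb{Z}$, at least one of the sequences $\{\Gamma^{(n)}(q)\}_{n\ge1}$ and $\{\Gamma^{(n)}(1-q)\}_{n\ge1}$ contains infinitely many transcendental elements; that is, $\Gamma^{(n)}(q)$ is transcendental for infinitely many $n\ge1$, or $\Gamma^{(n)}(1-q)$ is transcendental for infinitely many $n\ge1$. -/

import Mathlib

/-! By reflection, `Γ(x)Γ(1-x) = π / sin(πx)`; differentiate this `n` times at `q`. If almost all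
derivatives of `Γ` at `q` and `1 - q` were algebraic, then for large `n` each Leibniz term would
have an algebraic factor, so the sum would lie in a fixed finite-dimensional space over the real
algebraic numbers (`exists_finiteDimensional_antidiagonal_sum_mem`). The other side is an algebraic
multiple of `π ^ (n + 1)`, nonzero for infinitely many `n`, so infinitely many powers of `π` would
lie in that space. This contradicts the transcendence of `π`, which is proved here by Lindemann's
method. -/

/-! ### Transcendence of π -/

open Polynomial in
theorem exists_int_polynomial_of_galois_invariant {K : Type*} [Field K] [Algebra ℚ K]
    [IsGalois ℚ K] (M : Multiset K) (hM : ∀ σ : Gal(K/ℚ), M.map σ = M) :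
    ∃ (f : ℤ[X]) (a : ℤ), a ≠ 0 ∧
      f.map (Int.castRingHom K) = C (a : K) * (M.map fun x => X - C x).prod := by
  set g : K[X] := (M.map fun x => X - C x).prod with hg
  have hfix : ∀ σ : Gal(K/ℚ), g.map (σ : K →+* K) = g := by
    intro σ
    conv_rhs => rw [hg, ← hM σ]
    rw [hg, Polynomial.map_multiset_prod]
    simp [Multiset.map_map]
  have hlift : g ∈ Polynomial.lifts (algebraMap ℚ K) := by
    rw [Polynomial.lifts_iff_coeff_lifts]
    intro n
    rw [InfiniteGalois.mem_range_algebraMap_iff_fixed]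
    intro σ
    conv_rhs => rw [← hfix σ]
    simp
  obtain ⟨g₀, hg₀⟩ := (Polynomial.mem_lifts _).1 hlift
  obtain ⟨b, hb, hbmap⟩ := IsLocalization.integerNormalization_spec (nonZeroDivisors ℤ) g₀
  refine ⟨IsLocalization.integerNormalization (nonZeroDivisors ℤ) g₀, b,
    nonZeroDivisors.ne_zero hb, ?_⟩
  have h := congrArg (Polynomial.map (algebraMap ℚ K)) hbmap
  rw [Polynomial.map_map, zsmul_eq_mul, Polynomial.map_mul, hg₀] at h
  rw [Subsingleton.elim (Int.castRingHom K) ((algebraMap ℚ K).comp (algebraMap ℤ ℚ)), h]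
  simp

theorem exists_int_eq_of_galois_invariant {K : Type*} [Field K] [Algebra ℚ K]
    [IsGalois ℚ K] {x : K} (hx : IsIntegral ℤ x) (hσ : ∀ σ : Gal(K/ℚ), σ x = x) :
    ∃ n : ℤ, x = n := by
  obtain ⟨r, rfl⟩ := (InfiniteGalois.mem_range_algebraMap_iff_fixed x).2 hσ
  obtain ⟨n, rfl⟩ := IsIntegrallyClosed.algebraMap_eq_of_integral
    ((isIntegral_algebraMap_iff (algebraMap ℚ K).injective).1 hx)
  exact ⟨n, by simp⟩

open Polynomial in
theorem isIntegral_pow_mul_aeval {K : Type*} [CommRing K] {x : K} {a : ℤ}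
    (hx : IsIntegral ℤ ((a : K) * x)) (g : ℤ[X]) {N : ℕ} (hN : g.natDegree ≤ N) :
    IsIntegral ℤ ((a : K) ^ N * aeval x g) := by
  rw [aeval_eq_sum_range' (Nat.lt_succ_of_le hN), Finset.mul_sum]
  refine IsIntegral.sum _ fun i hi => ?_
  have hi' : i ≤ N := Nat.lt_succ_iff.1 (Finset.mem_range.1 hi)
  have : (a : K) ^ N * g.coeff i • x ^ i
      = ((a ^ (N - i) * g.coeff i : ℤ) : K) * ((a : K) * x) ^ i := by
    nth_rw 1 [zsmul_eq_mul, ← Nat.sub_add_cancel hi', pow_add]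
    push_cast
    ring
  rw [this]
  exact (isIntegral_algebraMap (R := ℤ) (A := K)).mul (hx.pow i)

-- Hermite–Lindemann: for large primes `p`, `exp_polynomial_approx` approximates `n * exp r` by `p *
-- g(r)` at all roots `r` of `f`, with `p ∤ n`. If the sum vanished, clearing denominators by `a ^
-- (p * D)` would give an integer that is nonzero mod `p` yet smaller than 1 in absolute value.
open Polynomial in
theorem intCast_add_sum_exp_ne_zero {K : Type*} [Field K] [Algebra ℚ K] [IsGalois ℚ K]
    (φ : K →+* ℂ) (M : Multiset K) (hM : ∀ σ : Gal(K/ℚ), M.map σ = M) (h0 : 0 ∉ M)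
    {k : ℤ} (hk : k ≠ 0) :
    (k : ℂ) + (M.map fun x => Complex.exp (φ x)).sum ≠ 0 := by
  intro hsum
  have hK : CharZero K := algebraRat.charZero K
  obtain ⟨f, a, ha, hf⟩ := exists_int_polynomial_of_galois_invariant M hM
  have haK : (a : K) ≠ 0 := Int.cast_ne_zero.2 ha
  have hroots : f.aroots ℂ = M.map φ := by
    rw [aroots, Subsingleton.elim (algebraMap ℤ ℂ) (φ.comp (Int.castRingHom K)),
      ← Polynomial.map_map, hf, Polynomial.map_mul, Polynomial.map_C, map_intCast,
      roots_C_mul _ (Int.cast_ne_zero.2 ha), Polynomial.map_multiset_prod, Multiset.map_map,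
      ← roots_multiset_prod_X_sub_C (M.map φ), Multiset.map_map]
    simp
  have heval : ∀ x : K, aeval x f = a * (M.map fun y => x - y).prod := by
    intro x
    rw [aeval_def, Subsingleton.elim (algebraMap ℤ K) (Int.castRingHom K), ← eval_map, hf,
      eval_mul, eval_multiset_prod, Multiset.map_map]
    simp
  have hf0 : f.eval 0 ≠ 0 := by
    intro h
    have h2 := heval 0
    rw [aeval_def, eval₂_at_zero, coeff_zero_eq_eval_zero, h] at h2
    simp only [map_zero, zero_sub, zero_eq_mul, haK, false_or, Multiset.prod_eq_zero_iff,
      Multiset.mem_map, neg_eq_zero, exists_eq_right] at h2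
    exact h0 h2
  have hlead : f.leadingCoeff = a := by
    have h := congrArg leadingCoeff hf
    rw [leadingCoeff_map_of_injective Int.cast_injective, leadingCoeff_mul, leadingCoeff_C,
      (monic_multiset_prod_of_monic _ _ fun x _ => monic_X_sub_C x).leadingCoeff, mul_one] at h
    exact Int.cast_injective h
  have hint : ∀ x ∈ M, IsIntegral ℤ ((a : K) * x) := by
    intro x hx
    have : aeval x f = 0 := by
      rw [heval, Multiset.prod_eq_zero (Multiset.mem_map.2 ⟨x, hx, sub_self x⟩), mul_zero]
    simpa [hlead] using isIntegral_leadingCoeff_smul f x this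
  obtain ⟨c, hc⟩ := LindemannWeierstrass.exp_polynomial_approx f hf0
  set D := f.natDegree
  have hlim : Filter.Tendsto (fun p : ℕ => (Multiset.card M : ℝ) * (|(a : ℝ)| ^ D * |c|) *
      ((|(a : ℝ)| ^ D * |c|) ^ (p - 1) / (p - 1).factorial)) Filter.atTop (nhds 0) := by
    have := ((FloorSemiring.tendsto_pow_div_factorial_atTop (|(a : ℝ)| ^ D * |c|)).comp
      (Filter.tendsto_sub_atTop_nat 1)).const_mul ((Multiset.card M : ℝ) * (|(a : ℝ)| ^ D * |c|))
    simpa using this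
  obtain ⟨P₀, hP₀⟩ := Filter.eventually_atTop.1 (hlim.eventually (gt_mem_nhds one_pos))
  -- `P₀` makes the error small; the other summands ensure that the approximation applies and that
  -- `p` divides neither `a` nor `k`.
  obtain ⟨p, hpge, hp⟩ := Nat.exists_infinite_primes
    (P₀ + (f.eval 0).natAbs + a.natAbs + k.natAbs + 1)
  obtain ⟨n, hn, g, hg, hgr⟩ := hc p (by omega) hp
  obtain ⟨N, hN⟩ : ∃ N : ℤ, (a : K) ^ (p * D) * (M.map fun x => aeval x g).sum = N := by
    apply exists_int_eq_of_galois_invariant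
    · rw [← Multiset.sum_map_mul_left]
      refine IsIntegral.multiset_sum fun y hy => ?_
      obtain ⟨x, hx, rfl⟩ := Multiset.mem_map.1 hy
      exact isIntegral_pow_mul_aeval (hint x hx) g (hg.trans (Nat.sub_le _ _))
    · intro σ
      have : (M.map fun x => aeval x g).sum = (M.map fun x => aeval (σ x) g).sum := by
        conv_lhs => rw [← hM σ, Multiset.map_map]
        rfl
      conv_rhs => rw [this]
      rw [map_mul, map_multiset_sum, Multiset.map_map]
      simp only [map_pow, map_intCast, Function.comp_def]
      congr 3
      funext x
      exact (aeval_algHom_apply ((σ : K →+* K).toIntAlgHom) x g).symm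
  have hNC : (a : ℂ) ^ (p * D) * (M.map fun x => aeval (φ x) g).sum = N := by
    have h := congrArg φ hN
    rw [map_mul, map_pow, map_intCast, map_intCast, map_multiset_sum, Multiset.map_map] at h
    rw [← h]
    congr 3
    funext x
    exact aeval_algHom_apply φ.toIntAlgHom x g
  have hbound : ‖(n : ℂ) * (M.map fun x => Complex.exp (φ x)).sum
      - p * (M.map fun x => aeval (φ x) g).sum‖
      ≤ Multiset.card M * (c ^ p / (p - 1).factorial) := by
    rw [← Multiset.sum_map_mul_left, ← Multiset.sum_map_mul_left, ← Multiset.sum_map_sub]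
    refine (norm_multiset_sum_le _).trans ?_
    refine (Multiset.sum_le_card_nsmul _ (c ^ p / (p - 1).factorial) ?_).trans ?_
    · intro y hy
      simp only [Multiset.map_map, Multiset.mem_map] at hy
      obtain ⟨x, hx, rfl⟩ := hy
      have := hgr (r := φ x) (by rw [hroots]; exact Multiset.mem_map_of_mem _ hx)
      simpa using this
    · simp
  set Z : ℤ := a ^ (p * D) * n * k + p * N with hZ
  have hZ0 : Z ≠ 0 := by
    intro h
    have hdvd : (p : ℤ) ∣ a ^ (p * D) * n * k := ⟨-N, by linear_combination h⟩
    have hpZ := Nat.prime_iff_prime_int.1 hp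
    rcases hpZ.dvd_or_dvd hdvd with h1 | h1
    · rcases hpZ.dvd_or_dvd h1 with h2 | h2
      · have := Int.natAbs_dvd_natAbs.2 (hpZ.dvd_of_dvd_pow h2)
        have := Nat.le_of_dvd (Int.natAbs_pos.2 ha) this
        simp at this; omega
      · exact hn h2
    · have := Nat.le_of_dvd (Int.natAbs_pos.2 hk) (Int.natAbs_dvd_natAbs.2 h1)
      simp at this; omega
  have h1 : (1 : ℝ) ≤ ‖(Z : ℂ)‖ := by
    rw [Complex.norm_intCast]; exact_mod_cast Int.one_le_abs hZ0
  have h2 : (Z : ℂ) = -((a : ℂ) ^ (p * D) * ((n : ℂ) * (M.map fun x => Complex.exp (φ x)).sum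
      - p * (M.map fun x => aeval (φ x) g).sum)) := by
    rw [hZ]; push_cast; rw [← hNC]
    linear_combination (a : ℂ) ^ (p * D) * n * hsum
  rw [h2, norm_neg, norm_mul, norm_pow, Complex.norm_intCast] at h1
  have h3 := hP₀ p (by omega)
  have h4 : |(a : ℝ)| ^ (p * D) * (Multiset.card M * (c ^ p / (p - 1).factorial)) ≤
      (Multiset.card M : ℝ) * (|(a : ℝ)| ^ D * |c|) *
      ((|(a : ℝ)| ^ D * |c|) ^ (p - 1) / (p - 1).factorial) := by
    have hcp : c ^ p ≤ |c| ^ p := by rw [← abs_pow]; exact le_abs_self _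
    calc _ ≤ |(a : ℝ)| ^ (p * D) * (Multiset.card M * (|c| ^ p / (p - 1).factorial)) := by gcongr
      _ = (Multiset.card M : ℝ) * ((|(a : ℝ)| ^ D * |c|) ^ p / (p - 1).factorial) := by
        rw [mul_pow, ← pow_mul, mul_comm D]; ring
      _ = _ := by
        rw [← mul_pow_sub_one hp.ne_zero]; ring
  have h5 := mul_le_mul_of_nonneg_left hbound (by positivity : 0 ≤ |(a : ℝ)| ^ (p * D))
  linarith

-- Expanding the product gives exponentials of subset sums of the roots. The vanishing sums, among
-- them the empty one, contribute a positive integer; the others form a Galois-stable multiset.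
open Polynomial in
theorem prod_one_add_exp_aroots_ne_zero {K : Type*} [Field K] [DecidableEq K] [Algebra ℚ K]
    [IsGalois ℚ K] (φ : K →+* ℂ) (P : ℚ[X]) :
    ∏ x ∈ (P.aroots K).toFinset, (1 + Complex.exp (φ x)) ≠ 0 := by
  set s := (P.aroots K).toFinset with hs
  have hmem : ∀ (σ : Gal(K/ℚ)) (x : K), σ x ∈ s ↔ x ∈ s := by
    intro σ x
    simp [hs, aeval_algHom_apply]
  have hinv : ∀ σ : Gal(K/ℚ), s.map σ.toEquiv.toEmbedding = s := by
    intro σ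
    ext x
    rw [Finset.mem_map_equiv, ← hmem σ]
    exact iff_of_eq (congrArg (· ∈ s) (σ.apply_symm_apply x))
  set b : Finset K → K := fun t => ∑ x ∈ t, x with hb
  set M := (s.powerset.filter fun t => b t ≠ 0).val.map b with hMdef
  set k := (s.powerset.filter fun t => ¬ b t ≠ 0).card with hk
  have hsum : ∏ x ∈ s, (1 + Complex.exp (φ x))
      = (k : ℤ) + (M.map fun x => Complex.exp (φ x)).sum := by
    rw [Finset.prod_one_add, ← Finset.sum_filter_add_sum_filter_not _ (fun t => b t ≠ 0), add_comm]
    congr 1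
    · rw [hk, Finset.card_eq_sum_ones]
      push_cast
      refine Finset.sum_congr rfl fun t ht => ?_
      have : b t = 0 := by simpa using (Finset.mem_filter.1 ht).2
      rw [← Complex.exp_sum, ← map_sum]
      simp [show ∑ x ∈ t, x = 0 from this]
    · rw [hMdef, Multiset.map_map]
      refine Finset.sum_congr rfl fun t ht => ?_
      simp [hb, Complex.exp_sum]
  rw [hsum]
  refine intCast_add_sum_exp_ne_zero φ M ?_ ?_ ?_
  · intro σ
    have hbσ : ∀ t, b (t.map σ.toEquiv.toEmbedding) = σ (b t) := by
      intro t
      simp [hb]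
    set T := s.powerset.filter fun t => b t ≠ 0 with hT
    have hTσ : T.map (Finset.mapEmbedding σ.toEquiv.toEmbedding).toEmbedding = T := by
      apply Finset.eq_of_subset_of_card_le
      · intro t ht
        obtain ⟨u, hu, rfl⟩ := Finset.mem_map.1 ht
        rw [hT, Finset.mem_filter, Finset.mem_powerset] at hu ⊢
        refine ⟨?_, ?_⟩
        · rw [← hinv σ]
          exact Finset.map_subset_map.2 hu.1
        · change b (u.map σ.toEquiv.toEmbedding) ≠ 0
          rw [hbσ]
          exact (map_ne_zero σ).2 hu.2
      · simp
    calc M.map σ = T.val.map fun t => σ (b t) := by rw [hMdef, Multiset.map_map]; rfl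
      _ = (T.map (Finset.mapEmbedding σ.toEquiv.toEmbedding).toEmbedding).val.map b := by
        rw [Finset.map_val, Multiset.map_map]
        exact Multiset.map_congr rfl fun t _ => (hbσ t).symm
      _ = M := by rw [hTσ]
  · simp [hMdef]
  · have : ∅ ∈ s.powerset.filter fun t => ¬ b t ≠ 0 := by simp [hb]
    have := Finset.card_pos.2 ⟨_, this⟩
    omega

theorem transcendental_pi : Transcendental ℚ Real.pi := by
  classical
  intro h
  have hC : IsAlgebraic ℚ ((Real.pi : ℂ) * Complex.I) := by
    refine (h.algHom (Complex.ofRealAm.restrictScalars ℚ)).mul ?_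
    exact ⟨Polynomial.X ^ 2 + 1, by
      rw [← Polynomial.C_1]; exact Polynomial.X_pow_add_C_ne_zero two_pos _, by simp⟩
  let x : algebraicClosure ℚ ℂ := ⟨_, mem_algebraicClosure_iff.2 hC⟩
  let : Algebra ℚ (algebraicClosure ℚ ℂ) := (algebraicClosure ℚ ℂ).algebra'
  have : IsAlgClosure ℚ (algebraicClosure ℚ ℂ) := algebraicClosure.isAlgClosure ℚ ℂ
  have : Algebra.IsAlgebraic ℚ (algebraicClosure ℚ ℂ) := algebraicClosure.isAlgebraic ℚ ℂ
  have : IsGalois ℚ (algebraicClosure ℚ ℂ) := ⟨⟩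
  have hx : IsIntegral ℚ x := Algebra.IsIntegral.isIntegral x
  refine prod_one_add_exp_aroots_ne_zero (algebraMap (algebraicClosure ℚ ℂ) ℂ) (minpoly ℚ x)
    (Finset.prod_eq_zero (i := x) ?_ ?_)
  · simp [minpoly.ne_zero hx]
  · rw [show algebraMap (algebraicClosure ℚ ℂ) ℂ x = (Real.pi : ℂ) * Complex.I from rfl,
      Complex.exp_pi_mul_I, add_neg_cancel]

/-! ### Derivatives of Γ and of π / sin(πx) -/

open Polynomial in
theorem Transcendental.exists_pow_notMem {F E : Type*} [Field F] [Field E] [Algebra F E] {x : E}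
    (hx : Transcendental F x) (V : Submodule F E) [FiniteDimensional F V] {S : Set ℕ}
    (hS : S.Infinite) : ∃ n ∈ S, x ^ n ∉ V := by
  by_contra! h
  have hli : LinearIndependent F fun n : ℕ => x ^ n := by
    have := (basisMonomials F).linearIndependent.map' (Polynomial.aeval x : F[X] →ₐ[F] E).toLinearMap
      (LinearMap.ker_eq_bot.2 (transcendental_iff_injective.1 hx))
    have hfun : (Polynomial.aeval x : F[X] →ₐ[F] E).toLinearMap ∘ basisMonomials F =
        fun n : ℕ => x ^ n := by
      ext n
      simp
    rwa [hfun] at this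
  have hli' : LinearIndependent F fun n : S => (⟨x ^ (n : ℕ), h n n.2⟩ : V) :=
    LinearIndependent.of_comp V.subtype (hli.comp _ Subtype.val_injective)
  have := hli'.finite
  exact hS (Set.toFinite S)

theorem Real.analyticAt_Gamma {s : ℝ} (hs : ∀ m : ℕ, s ≠ -m) : AnalyticAt ℝ Real.Gamma s := by
  have hopen : IsOpen {z : ℂ | (Complex.Gamma z)⁻¹ ≠ 0} :=
    isOpen_ne_fun Complex.differentiable_one_div_Gamma.continuous continuous_const
  have hne : ∀ z : ℂ, (Complex.Gamma z)⁻¹ ≠ 0 ↔ ∀ m : ℕ, z ≠ -m := by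
    intro z
    rw [Ne, inv_eq_zero, Complex.Gamma_eq_zero_iff]
    push Not
    rfl
  have hd : DifferentiableOn ℂ Complex.Gamma {z : ℂ | (Complex.Gamma z)⁻¹ ≠ 0} := fun z hz =>
    (Complex.differentiableAt_Gamma z ((hne z).1 hz)).differentiableWithinAt
  have ha : AnalyticAt ℂ Complex.Gamma s := hd.analyticAt
    (hopen.mem_nhds ((hne s).2 fun m hm => hs m (by exact_mod_cast hm)))
  have := ha.re_ofReal
  simpa [Complex.Gamma_ofReal] using this

/-- Otherwise the Taylor series is a polynomial `P`, and the identity theorem extends `P x * sin(πx)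
= π` to all real `x`, which fails at `x = 0`. -/
theorem infinite_iteratedDeriv_pi_div_sin_ne_zero {s : ℝ} (hs : Real.sin (Real.pi * s) ≠ 0) :
    {n : ℕ | iteratedDeriv n (fun x => Real.pi / Real.sin (Real.pi * x)) s ≠ 0}.Infinite := by
  intro hfin
  set h : ℝ → ℝ := fun x => Real.pi / Real.sin (Real.pi * x) with hh
  have hsin : ∀ x : ℝ, AnalyticAt ℝ (fun x => Real.sin (Real.pi * x)) x := by
    intro x
    fun_prop
  have han : AnalyticAt ℝ h s := analyticAt_const.div (hsin s) hs
  set P : ℝ → ℝ := fun x => ∑ n ∈ hfin.toFinset, (x - s) ^ n * (iteratedDeriv n h s / n.factorial)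
  have hloc : ∀ᶠ x in nhds s, h x = P x := by
    have := han.hasFPowerSeriesAt.eventually_hasSum_sub
    filter_upwards [this] with x hx
    have hx2 : HasSum (fun n => (x - s) ^ n * (iteratedDeriv n h s / n.factorial)) (h x) := by
      simpa [FormalMultilinearSeries.ofScalars_apply_eq, mul_comm] using hx
    refine hx2.unique (hasSum_sum_of_ne_finset_zero fun n hn => ?_)
    have : iteratedDeriv n h s = 0 := by simpa using hn
    simp [this]
  have hP : AnalyticOnNhd ℝ P Set.univ := by
    intro x _
    simp only [P]
    fun_prop
  have hne : ∀ᶠ x in nhds s, Real.sin (Real.pi * x) ≠ 0 := (hsin s).continuousAt.eventually_ne hs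
  have heq : (fun x => P x * Real.sin (Real.pi * x)) = fun _ => Real.pi := by
    refine AnalyticOnNhd.eq_of_eventuallyEq (𝕜 := ℝ) (z₀ := s)
      (fun x hx => (hP x hx).mul (hsin x)) (fun x _ => analyticAt_const) ?_
    filter_upwards [hloc, hne] with x hx hx2
    rw [← hx, hh]
    field_simp
  have := congrFun heq 0
  simp at this
  exact Real.pi_ne_zero this.symm

theorem isAlgebraic_iteratedDeriv_sin_rat_mul_pi (q : ℚ) (n : ℕ) :
    IsAlgebraic ℚ (iteratedDeriv n Real.sin (Real.pi * q)) ∧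
      IsAlgebraic ℚ (iteratedDeriv n Real.cos (Real.pi * q)) := by
  have h1 : IsAlgebraic ℚ (Real.sin (Real.pi * q)) := by
    rw [mul_comm]
    exact (Real.isAlgebraic_sin_rat_mul_pi q).extendScalars Int.cast_injective
  have h2 : IsAlgebraic ℚ (Real.cos (Real.pi * q)) := by
    rw [mul_comm]
    exact (Real.isAlgebraic_cos_rat_mul_pi q).extendScalars Int.cast_injective
  induction n with
  | zero => simpa using ⟨h1, h2⟩
  | succ n ih =>
    rw [Real.iteratedDeriv_add_one_sin, Real.iteratedDeriv_add_one_cos]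
    exact ⟨ih.2, ih.1.neg⟩

/-- Apply Leibniz to `h x * sin(πx) = π` and solve for the top derivative of `h`; the powers of `π`
match term by term. -/
theorem isAlgebraic_iteratedDeriv_pi_div_sin (q : ℚ) (hq : Real.sin (Real.pi * q) ≠ 0) (n : ℕ) :
    IsAlgebraic ℚ (iteratedDeriv n (fun x => Real.pi / Real.sin (Real.pi * x)) q /
      Real.pi ^ (n + 1)) := by
  set h : ℝ → ℝ := fun x => Real.pi / Real.sin (Real.pi * x) with hh
  have hsin : ∀ x : ℝ, AnalyticAt ℝ (fun x => Real.sin (Real.pi * x)) x := by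
    intro x
    fun_prop
  have han : AnalyticAt ℝ h q := analyticAt_const.div (hsin q) hq
  have hne : ∀ᶠ x in nhds (q : ℝ), Real.sin (Real.pi * x) ≠ 0 :=
    (hsin q).continuousAt.eventually_ne hq
  have hprod : (fun x => h x * Real.sin (Real.pi * x)) =ᶠ[nhds (q : ℝ)] fun _ => Real.pi := by
    filter_upwards [hne] with x hx
    simp only [hh]
    field_simp
  induction n using Nat.strong_induction_on with
  | _ n ih =>
  have hL := hprod.iteratedDeriv_eq n
  rw [iteratedDeriv_fun_mul han.contDiffAt (hsin q).contDiffAt, Finset.sum_range_succ] at hL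
  simp only [iteratedDeriv_comp_const_mul Real.contDiff_sin, Nat.choose_self, Nat.sub_self,
    iteratedDeriv_zero, pow_zero, one_mul, Nat.cast_one] at hL
  set D := iteratedDeriv n (fun _ : ℝ => Real.pi) (q : ℝ)
  have hD : IsAlgebraic ℚ (D / Real.pi ^ (n + 1)) := by
    simp only [D, iteratedDeriv_const]
    split_ifs with h0
    · subst h0
      simpa [Real.pi_ne_zero] using isAlgebraic_one
    · simpa using isAlgebraic_zero
  have hkey : iteratedDeriv n h q / Real.pi ^ (n + 1) =
      (D / Real.pi ^ (n + 1) - ∑ i ∈ Finset.range n, (n.choose i : ℝ) *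
        (iteratedDeriv i h q / Real.pi ^ (i + 1)) *
          iteratedDeriv (n - i) Real.sin (Real.pi * q)) / Real.sin (Real.pi * q) := by
    have hsum : (∑ i ∈ Finset.range n, (n.choose i : ℝ) * iteratedDeriv i h q *
        (Real.pi ^ (n - i) * iteratedDeriv (n - i) Real.sin (Real.pi * q))) / Real.pi ^ (n + 1) =
        ∑ i ∈ Finset.range n, (n.choose i : ℝ) * (iteratedDeriv i h q / Real.pi ^ (i + 1)) *
          iteratedDeriv (n - i) Real.sin (Real.pi * q) := by
      rw [Finset.sum_div]
      refine Finset.sum_congr rfl fun i hi => ?_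
      have hi' : n = (n - i) + i := (Nat.sub_add_cancel (Finset.mem_range.1 hi).le).symm
      have hpow : Real.pi ^ (n + 1) = Real.pi ^ (n - i) * Real.pi ^ (i + 1) := by
        rw [← pow_add, ← add_assoc, ← hi']
      rw [hpow]
      have := Real.pi_ne_zero
      field_simp
    rw [eq_div_iff hq, ← hL, ← hsum]
    ring
  rw [hkey, div_eq_mul_inv _ (Real.sin _)]
  have hs0 := (isAlgebraic_iteratedDeriv_sin_rat_mul_pi q 0).1
  rw [iteratedDeriv_zero] at hs0
  refine (hD.sub ?_).mul hs0.inv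
  refine mem_algebraicClosure_iff.1 (sum_mem fun i hi => mem_algebraicClosure_iff.2 ?_)
  exact ((isAlgebraic_natCast _).mul (ih i (Finset.mem_range.1 hi))).mul
    (isAlgebraic_iteratedDeriv_sin_rat_mul_pi q _).1

theorem exists_finiteDimensional_antidiagonal_sum_mem {F E : Type*} [Field F] [Field E]
    [Algebra F E] {a b : ℕ → E} {N : ℕ} (ha : ∀ n, N ≤ n → a n ∈ (algebraMap F E).range)
    (hb : ∀ n, N ≤ n → b n ∈ (algebraMap F E).range) :
    ∃ V : Submodule F E, FiniteDimensional F V ∧ ∀ n, 2 * N ≤ n → ∀ u : ℕ → F,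
      ∑ i ∈ Finset.range (n + 1), algebraMap F E (u i) * a i * b (n - i) ∈ V := by
  set V : Submodule F E := Submodule.span F
    ({1} ∪ (a '' Set.Iio N ∪ b '' Set.Iio N)) with hV
  have h1 : (1 : E) ∈ V := Submodule.subset_span (by simp)
  have haV : ∀ i, a i ∈ V := by
    intro i
    by_cases hi : i < N
    · exact Submodule.subset_span (Or.inr (Or.inl ⟨i, hi, rfl⟩))
    · obtain ⟨r, hr⟩ := ha i (not_lt.1 hi)
      rw [← hr, Algebra.algebraMap_eq_smul_one]
      exact V.smul_mem r h1
  have hbV : ∀ i, b i ∈ V := by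
    intro i
    by_cases hi : i < N
    · exact Submodule.subset_span (Or.inr (Or.inr ⟨i, hi, rfl⟩))
    · obtain ⟨r, hr⟩ := hb i (not_lt.1 hi)
      rw [← hr, Algebra.algebraMap_eq_smul_one]
      exact V.smul_mem r h1
  refine ⟨V, FiniteDimensional.span_of_finite F (Set.toFinite _), fun n hn u => ?_⟩
  refine V.sum_mem fun i _ => ?_
  rw [mul_assoc, ← Algebra.smul_def]
  refine V.smul_mem _ ?_
  -- Since `n ≥ 2N`, either `i ≥ N` or `n - i ≥ N`, so one factor is a scalar.
  by_cases hi : N ≤ i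
  · obtain ⟨r, hr⟩ := ha i hi
    rw [← hr, ← Algebra.smul_def]
    exact V.smul_mem r (hbV _)
  · obtain ⟨r, hr⟩ := hb (n - i) (by omega)
    rw [← hr, mul_comm, ← Algebra.smul_def]
    exact V.smul_mem r (haV _)

theorem theorem2 (q : ℚ) (hq : ∀ k : ℤ, q ≠ (k : ℚ) / 2) :
    {n : ℕ | 1 ≤ n ∧ Transcendental ℚ (iteratedDeriv n Real.Gamma (q : ℝ))}.Infinite ∨
    {n : ℕ | 1 ≤ n ∧ Transcendental ℚ (iteratedDeriv n Real.Gamma (1 - (q : ℝ)))}.Infinite := by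
  by_contra! hcon
  obtain ⟨hfin₁, hfin₂⟩ := hcon
  have hint : ∀ k : ℤ, (q : ℝ) ≠ k := by
    intro k hk
    refine hq (2 * k) ?_
    have : q = k := by exact_mod_cast hk
    rw [this]
    push_cast
    ring
  have hsin : Real.sin (Real.pi * q) ≠ 0 := by
    rw [Real.sin_ne_zero_iff]
    intro k hk
    refine hint k (mul_left_cancel₀ Real.pi_ne_zero ?_)
    linarith
  have evalg : ∀ s : ℝ, {n : ℕ | 1 ≤ n ∧ Transcendental ℚ (iteratedDeriv n Real.Gamma s)}.Finite →
      ∃ N, ∀ n, N ≤ n → IsAlgebraic ℚ (iteratedDeriv n Real.Gamma s) := by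
    intro s hs
    obtain ⟨N, hN⟩ := hs.bddAbove
    refine ⟨N + 1, fun n hn => ?_⟩
    by_contra h
    have := hN ⟨by omega, h⟩
    omega
  obtain ⟨N₁, hN₁⟩ := evalg _ hfin₁
  obtain ⟨N₂, hN₂⟩ := evalg _ hfin₂
  have hΓ₁ : AnalyticAt ℝ Real.Gamma q :=
    Real.analyticAt_Gamma fun m hm => hint (-m) (by push_cast; exact hm)
  have hΓ₂ : AnalyticAt ℝ (fun x => Real.Gamma (1 - x)) q := by
    have : AnalyticAt ℝ Real.Gamma (1 - q) :=
      Real.analyticAt_Gamma fun m hm => hint (m + 1) (by push_cast; linarith)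
    exact this.fun_comp (by fun_prop)
  set h : ℝ → ℝ := fun x => Real.pi / Real.sin (Real.pi * x) with hh
  have hrefl : h = fun x => Real.Gamma x * Real.Gamma (1 - x) :=
    funext fun x => (Real.Gamma_mul_Gamma_one_sub x).symm
  set F := algebraicClosure ℚ ℝ
  have hF : ∀ {x : ℝ}, IsAlgebraic ℚ x → x ∈ (algebraMap F ℝ).range := fun {x} hx =>
    ⟨⟨x, mem_algebraicClosure_iff.2 hx⟩, rfl⟩
  obtain ⟨V, hV, hmem⟩ := exists_finiteDimensional_antidiagonal_sum_mem (F := F) (E := ℝ)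
    (a := fun n => iteratedDeriv n Real.Gamma q)
    (b := fun n => iteratedDeriv n (fun x => Real.Gamma (1 - x)) q) (N := max N₁ N₂)
    (fun n hn => hF (hN₁ n ((le_max_left _ _).trans hn)))
    (fun n hn => by
      apply hF
      simp only [iteratedDeriv_comp_const_sub, smul_eq_mul]
      exact ((isAlgebraic_one.neg).pow n).mul (hN₂ n ((le_max_right _ _).trans hn)))
  have hinf : {n : ℕ | iteratedDeriv n h q ≠ 0 ∧ 2 * max N₁ N₂ ≤ n}.Infinite := by
    have := (infinite_iteratedDeriv_pi_div_sin_ne_zero hsin).sdiff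
      (Set.finite_lt_nat (2 * max N₁ N₂))
    refine this.mono fun n hn => ⟨hn.1, not_lt.1 hn.2⟩
  -- The successor image accounts for the exponent `n + 1` of `π`. Transcendence is needed over the
  -- real algebraic numbers, not just over `ℚ`.
  obtain ⟨_, ⟨n, ⟨hn0, hn⟩, rfl⟩, hnot⟩ :=
    transcendental_pi.algebraicClosure.exists_pow_notMem V
      (hinf.image (Nat.succ_injective.injOn))
  apply hnot
  obtain ⟨c, hc⟩ := hF (isAlgebraic_iteratedDeriv_pi_div_sin q hsin n)
  have hVn : iteratedDeriv n h q ∈ V := by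
    rw [hrefl, iteratedDeriv_fun_mul hΓ₁.contDiffAt hΓ₂.contDiffAt]
    simpa using hmem n hn fun i => (n.choose i : F)
  have hc' : iteratedDeriv n h q = algebraMap F ℝ c * Real.pi ^ (n + 1) := by
    rw [hc, div_mul_cancel₀ _ (pow_ne_zero _ Real.pi_ne_zero)]
  have hc0 : c ≠ 0 := by
    rintro rfl
    exact hn0 (by rw [hc', map_zero, zero_mul])
  rw [hc', ← Algebra.smul_def] at hVn
  exact (V.smul_mem_iff hc0).1 hVn
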